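/- All graphs are finite, undirected, without loops or multiple edges. $P_r$ is the path on $r$ vertices, $G+H$ is the disjoint union of $G$ and $H$, $rG$ is the disjoint union of $r$ copies of $G$, and $\overline{G}$ is the complement of $G$. A graph $G$ is self-complementary if $G\cong\overline{G}$, and the bull is the graph obtained from a triangle by attaching one pendant vertex to each of two of its vertices. For a set ${\cal H}$ of graphs, a graph is ${\cal H}$-free if none of its induced subgraphs is isomorphic to a graph in ${\cal H}$. The clique-width of a graph is the minimum number of labels needed to construct it by the operations: creating a single vertex with label $i$; disjoint union of two labelled graphs; joining every vertex with label $i$ to every vertex with label $j$ ($i\neq j$); renaming label $i$ to $j$. (The graph without vertices has clique-width $0$.) A class of graphs has unbounded clique-width if no constant bounds the clique-width of all its members. For $h\ge 1$, the wall of height $h$ has as vertices the points $(x,y)$ with $0\le x\le 2h+1$, $0\le y\le h$, except $(0,0)$ and except $(0,h)$ if $h$ is odd, $(2h+1,h)$ if $h$ is even; its edges are the horizontal edges between $(x,y)$ and $(x+1,y)$ and the vertical edges between $(x,y)$ and $(x,y+1)$ with $x+y$ odd. Let $W_h$ be obtained from the wall of height $h$ by subdividing every edge exactly once and then complementing the subgraph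 induced by each of the following three independent sets (so that each becomes a clique): the original vertices of the wall, the vertices subdividing vertical edges, and the vertices subdividing horizontal edges. **Theorem.** Let ${\cal F}$ be the set of all self-complementary graphs on at least five vertices that are not isomorphic to the bull. Then the class of $(\{4P_1,\overline{3P_1+P_2}\}\cup{\cal F})$-free graphs has unbounded clique-width. Moreover, every $W_h$ with $h\geq 1$ is $(\{4P_1,\overline{3P_1+P_2}\}\cup{\cal F})$-free, and the class $\{W_h : h\ge 1\}$ has unbounded clique-width. -/

import Mathlib

namespace CliqueWidth

open SimpleGraph

/-! ### Clique-width -/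

/-- Expressions over the label set `Fin k`, built from the four operations that define
clique-width. -/
inductive Expr (k : ℕ) : Type
  /-- a single vertex with label `i` -/
  | vertex (i : Fin k) : Expr k
  /-- disjoint union of two labelled graphs -/
  | union (s t : Expr k) : Expr k
  /-- join each vertex with label `i` to each vertex with label `j`, where `i ≠ j` -/
  | join (i j : Fin k) (hij : i ≠ j) (t : Expr k) : Expr k
  /-- rename label `i` to `j` -/
  | rename (i j : Fin k) (t : Expr k) : Expr k

namespace Expr

/-- The vertex set of the labelled graph constructed by an expression. -/
@[reducible] def Vert {k : ℕ} : Expr k → Type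
  | vertex _ => Unit
  | union s t => s.Vert ⊕ t.Vert
  | join _ _ _ t => t.Vert
  | rename _ _ t => t.Vert

/-- The labels of the labelled graph constructed by an expression. -/
def label {k : ℕ} : (t : Expr k) → t.Vert → Fin k
  | vertex i => fun _ => i
  | union s t => Sum.elim s.label t.label
  | join _ _ _ t => t.label
  | rename i j t => fun v => if t.label v = i then j else t.label v

/-- The underlying graph of the labelled graph constructed by an expression. -/
def graph {k : ℕ} : (t : Expr k) → SimpleGraph t.Vert
  | vertex _ => (⊥ : SimpleGraph Unit)
  | union s t => s.graph ⊕g t.graph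
  | join i j _ t => t.graph ⊔ SimpleGraph.fromRel (fun u v => t.label u = i ∧ t.label v = j)
  | rename _ _ t => t.graph

end Expr

/-- `G` can be constructed, up to isomorphism, with the labels in `Fin k`. -/
def Constructible {V : Type} (G : SimpleGraph V) (k : ℕ) : Prop :=
  ∃ t : Expr k, Nonempty (t.graph ≃g G)

/-- The clique-width: the minimum number of labels needed to construct `G`. Every finite graph
with a vertex is constructible with some number of labels; the graph without vertices is
given clique-width `0`. -/
noncomputable def cliqueWidth {V : Type} (G : SimpleGraph V) : ℕ :=
  sInf {k : ℕ | Constructible G k}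

/-! ### Classes of finite graphs -/

/-- A finite simple graph. -/
structure FinGraph where
  /-- the vertex set -/
  V : Type
  /-- the vertex set is finite -/
  finite : Finite V
  /-- the graph -/
  graph : SimpleGraph V

/-- A class of graphs has bounded clique-width if some constant bounds the clique-width of all
its members. -/
def HasBoundedCliqueWidth (𝒢 : Set FinGraph) : Prop :=
  ∃ c : ℕ, ∀ G ∈ 𝒢, cliqueWidth G.graph ≤ c

/-- A class of graphs has unbounded clique-width if it does not have bounded clique-width. -/
def HasUnboundedCliqueWidth (𝒢 : Set FinGraph) : Prop :=
  ¬ HasBoundedCliqueWidth 𝒢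

/-- The class of `ℋ`-free graphs: no induced subgraph is isomorphic to a graph in `ℋ`. -/
def freeGraphs (ℋ : Set FinGraph) : Set FinGraph :=
  {G | ∀ H ∈ ℋ, ¬ H.graph.IsIndContained G.graph}

/-- The graph `4P₁`: four isolated vertices. -/
def fourP1 : FinGraph :=
  ⟨Fin 4, inferInstance, ⊥⟩

/-- The complement of `3P₁ + P₂`. -/
def coThreeP1AddP2 : FinGraph :=
  ⟨Fin 3 ⊕ Fin 2, inferInstance, ((⊥ : SimpleGraph (Fin 3)) ⊕g pathGraph 2)ᶜ⟩

/-- The bull: a triangle `1, 2, 3` with pendant vertices `0` at `1` and `4` at `3`. -/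
def bull : SimpleGraph (Fin 5) :=
  SimpleGraph.fromEdgeSet {s(0, 1), s(1, 2), s(2, 3), s(3, 4), s(1, 3)}

/-- A graph is self-complementary if it is isomorphic to its complement. -/
def IsSelfComplementary {V : Type} (G : SimpleGraph V) : Prop :=
  Nonempty (G ≃g Gᶜ)

/-- All self-complementary graphs on at least five vertices that are not the bull. -/
def selfComplementaryNonBull : Set FinGraph :=
  {H | IsSelfComplementary H.graph ∧ 5 ≤ Nat.card H.V ∧ IsEmpty (H.graph ≃g bull)}

/-! ### Walls, their subdivisions, and complementation on a vertex set -/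

/-- The vertices of the wall of height `h`: the points `(x, y)` with `0 ≤ x ≤ 2h + 1` and
`0 ≤ y ≤ h`, except for the two corners that would have degree one, namely `(0, 0)` and, in the
top row, `(0, h)` if `h` is odd and `(2h + 1, h)` if `h` is even. -/
def WallVert (h : ℕ) : Type :=
  {p : Fin (2 * h + 2) × Fin (h + 1) //
    ¬ (p.1.val = 0 ∧ p.2.val = 0) ∧
    ¬ (p.1.val = (if Odd h then 0 else 2 * h + 1) ∧ p.2.val = h)}

/-- The column of a vertex of a wall. -/
def WallVert.x {h : ℕ} (p : WallVert h) : ℕ := p.1.1.val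

/-- The row of a vertex of a wall. -/
def WallVert.y {h : ℕ} (p : WallVert h) : ℕ := p.1.2.val

/-- The wall of height `h`: consecutive points of a row are adjacent, and `(x, y)` is adjacent to
`(x, y + 1)` if `x + y` is odd. -/
def wall (h : ℕ) : SimpleGraph (WallVert h) :=
  SimpleGraph.fromRel (fun p q =>
    (p.y = q.y ∧ q.x = p.x + 1) ∨ (p.x = q.x ∧ q.y = p.y + 1 ∧ Odd (p.x + p.y)))

/-- The graph obtained from `G` by subdividing every edge exactly once: the new vertices are the
edges of `G`, each adjacent to its two ends. -/
def subdivide {V : Type} (G : SimpleGraph V) : SimpleGraph (V ⊕ G.edgeSet) :=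
  SimpleGraph.fromRel (fun a b => ∃ (v : V) (e : G.edgeSet), a = Sum.inl v ∧ b = Sum.inr e ∧
    v ∈ e.val)

/-- Subgraph complementation on the vertex set `S`: edges inside `S` become non-edges and vice
versa. -/
def complementOn {V : Type} (G : SimpleGraph V) (S : Set V) : SimpleGraph V where
  Adj u v := u ≠ v ∧ ((u ∈ S ∧ v ∈ S ∧ ¬ G.Adj u v) ∨ (¬ (u ∈ S ∧ v ∈ S) ∧ G.Adj u v))
  symm := ⟨fun u v h => by
    have := G.adj_comm u v
    tauto⟩
  loopless := ⟨fun _ h => h.1 rfl⟩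

/-- The vertices of the subdivided wall that are vertices of the wall. -/
def wallV1 (h : ℕ) : Set (WallVert h ⊕ (wall h).edgeSet) :=
  Set.range Sum.inl

/-- The vertices of the subdivided wall that subdivide vertical edges. -/
def wallV2 (h : ℕ) : Set (WallVert h ⊕ (wall h).edgeSet) :=
  Sum.inr '' {e | ∀ p ∈ e.val, ∀ q ∈ e.val, p.x = q.x}

/-- The vertices of the subdivided wall that subdivide horizontal edges. -/
def wallV3 (h : ℕ) : Set (WallVert h ⊕ (wall h).edgeSet) :=
  Sum.inr '' {e | ∀ p ∈ e.val, ∀ q ∈ e.val, p.y = q.y}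

instance (h : ℕ) : Finite (WallVert h) := by
  unfold WallVert
  infer_instance

/-- The 1-subdivided wall of height `h` after complementing on each of its three natural
independent sets. -/
def complementedWall (h : ℕ) : FinGraph :=
  ⟨WallVert h ⊕ (wall h).edgeSet, inferInstance,
    complementOn (complementOn (complementOn (subdivide (wall h)) (wallV1 h)) (wallV2 h))
      (wallV3 h)⟩

end CliqueWidth

/-! Clique-width. At each node of a `k`-expression the vertices built so far fall into `k` classes
that look alike from outside. Descend to a union node whose vertex set `A ∪ B` contains a whole
inner row of the wall while neither `A` nor `B` does (`Constructible.exists_isCut_union`). Between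
wall vertices and wall edges, adjacency in `W_h` is still incidence, so a set with `k`
outside-classes splits at most `2k` rows and at most `2k` zigzag columns (`card_cuts_track_le`). If
`h - 1 > 4k`, some column is not split by `A ∪ B`; it meets the row inside `A ∪ B`, so it lies in `A
∪ B`, and hence every row meets `A ∪ B`. A row split neither by `A` nor by `A ∪ B` would then lie in
`A` or in `B`. So every inner row is split by one of the two sets, which gives `h - 1 ≤ 4k`, a
contradiction.

Freeness. Only local facts are needed, and they pass to induced subgraphs (`WallLike`): three
cliques, no edges between the vertical and the horizontal one, and bipartite incidences of bounded
degree with the first. Three cliques exclude `4P₁`, and a case analysis on colours excludes the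
complement of `3P₁ + P₂`. A self-complementary induced subgraph has at most three vertices in each
clique, since a complementing permutation turns cliques into independent sets. Counting edges then
leaves five vertices or one configuration on eight, which the vertices of degree 5 and 2 rule out
(`WallLike.card_eq_five`). On five vertices the only candidates are the bull and the 5-cycle, and
the colours exclude the 5-cycle. -/

namespace CliqueWidth

open SimpleGraph

/-! ### Cuts of graphs of bounded clique-width -/

/-- The vertices in `A` are distributed among `k` classes so that those of one class have the
same neighbours outside `A`. -/
def IsCut {V : Type} (G : SimpleGraph V) (k : ℕ) (A : Set V) : Prop :=
  ∃ l : V → Fin k, ∀ u ∈ A, ∀ v ∈ A, l u = l v → ∀ w ∉ A, G.Adj u w → G.Adj v w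

/-- Induction down the expression: at a union, move to a child that still satisfies `Q`, and stop
when there is none. `R` records which pairs of current labels are joined further up, so that
adjacency in `G` can be read off at an inner node. -/
lemma exists_isCut_union_of_expr {V : Type} (G : SimpleGraph V) {k : ℕ} (Q : Set V → Prop)
    (hsing : ∀ v, ¬ Q {v}) (t : Expr k) (f : t.Vert → V) (hf : Function.Injective f)
    (R : Fin k → Fin k → Prop)
    (hR : ∀ x y, x ≠ y → (G.Adj (f x) (f y) ↔ t.graph.Adj x y ∨ R (t.label x) (t.label y)))
    (hout : ∀ x y, t.label x = t.label y → ∀ w ∉ Set.range f, G.Adj (f x) w → G.Adj (f y) w)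
    (hQ : Q (Set.range f)) :
    ∃ A B : Set V, IsCut G k A ∧ IsCut G k B ∧ IsCut G k (A ∪ B) ∧
      Q (A ∪ B) ∧ ¬ Q A ∧ ¬ Q B := by
  have key : ∀ (t : Expr k) (f : t.Vert → V), Function.Injective f →
      (∀ x y, t.label x = t.label y → ∀ w ∉ Set.range f, G.Adj (f x) w → G.Adj (f y) w) →
      Nonempty t.Vert → IsCut G k (Set.range f) := by
    intro t f hf hout ⟨x₀⟩
    classical
    -- Vertices outside the range get an arbitrary label; a cut only compares labels inside the set.
    refine ⟨fun v => if h : ∃ x, f x = v then t.label h.choose else t.label x₀, ?_⟩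
    have hl : ∀ x, (if h : ∃ y, f y = f x then t.label h.choose else t.label x₀) = t.label x := by
      intro x
      have h : ∃ y, f y = f x := ⟨x, rfl⟩
      rw [dif_pos h, hf h.choose_spec]
    rintro _ ⟨x, rfl⟩ _ ⟨y, rfl⟩ hxy w hw
    simp only [hl] at hxy
    exact hout x y hxy w hw
  have hne : ∀ t : Expr k, Nonempty t.Vert := by
    intro t
    induction t with
    | vertex i => exact ⟨()⟩
    | union s t hs _ => exact ⟨Sum.inl hs.some⟩
    | join i j hij t ht => exact ht
    | rename i j t ht => exact ht
  induction t generalizing R with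
  | vertex i =>
    refine absurd hQ ?_
    have : Set.range f = {f ()} := by
      ext v
      exact ⟨fun ⟨_, h⟩ => h.symm, fun h => ⟨(), h.symm⟩⟩
    rw [this]
    exact hsing _
  | union s t hs ht =>
    have hrange : Set.range f = Set.range (f ∘ Sum.inl) ∪ Set.range (f ∘ Sum.inr) := by
      ext v; simp
    have h1 : Function.Injective (f ∘ Sum.inl) := hf.comp Sum.inl_injective
    have h2 : Function.Injective (f ∘ Sum.inr) := hf.comp Sum.inr_injective
    have o1 : ∀ x y, s.label x = s.label y → ∀ w ∉ Set.range (f ∘ Sum.inl),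
        G.Adj ((f ∘ Sum.inl) x) w → G.Adj ((f ∘ Sum.inl) y) w := by
      intro x y hxy w hw ha
      by_cases hw' : w ∈ Set.range f
      · obtain ⟨z | z, rfl⟩ := hw'
        · exact absurd ⟨z, rfl⟩ hw
        · have e1 := (hR (.inl x) (.inr z) (by simp)).1 ha
          refine (hR (.inl y) (.inr z) (by simp)).2 (Or.inr ?_)
          simpa [Expr.graph, Expr.label, hxy] using e1
      · exact hout (.inl x) (.inl y) hxy w hw' ha
    have o2 : ∀ x y, t.label x = t.label y → ∀ w ∉ Set.range (f ∘ Sum.inr),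
        G.Adj ((f ∘ Sum.inr) x) w → G.Adj ((f ∘ Sum.inr) y) w := by
      intro x y hxy w hw ha
      by_cases hw' : w ∈ Set.range f
      · obtain ⟨z | z, rfl⟩ := hw'
        · have e1 := (hR (.inr x) (.inl z) (by simp)).1 ha
          refine (hR (.inr y) (.inl z) (by simp)).2 (Or.inr ?_)
          simpa [Expr.graph, Expr.label, hxy] using e1
        · exact absurd ⟨z, rfl⟩ hw
      · exact hout (.inr x) (.inr y) hxy w hw' ha
    by_cases q1 : Q (Set.range (f ∘ Sum.inl))
    · refine hs _ h1 R (fun x y hxy => ?_) o1 q1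
      simpa [Expr.graph, Expr.label] using hR (.inl x) (.inl y) (by simpa using hxy)
    by_cases q2 : Q (Set.range (f ∘ Sum.inr))
    · refine ht _ h2 R (fun x y hxy => ?_) o2 q2
      simpa [Expr.graph, Expr.label] using hR (.inr x) (.inr y) (by simpa using hxy)
    refine ⟨_, _, key _ _ h1 o1 (hne _), key _ _ h2 o2 (hne _), ?_, ?_, q1, q2⟩
    · rw [← hrange]; exact key _ _ hf hout (hne _)
    · rwa [← hrange]
  | join i j hij t ht =>
    -- Below a join, its label pair is added to the joins still to come.
    refine ht f hf (fun a b => R a b ∨ (a = i ∧ b = j) ∨ (b = i ∧ a = j)) (fun x y hxy => ?_)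
      hout hQ
    rw [hR x y hxy]
    simp only [Expr.graph, Expr.label, SimpleGraph.sup_adj, SimpleGraph.fromRel_adj]
    tauto
  | rename i j t ht =>
    -- Below a renaming, later joins are pulled back along it.
    refine ht f hf (fun a b => R (if a = i then j else a) (if b = i then j else b)) hR
      (fun x y hxy => hout x y ?_) hQ
    simp [Expr.label, hxy]

lemma Constructible.exists_isCut_union {V : Type} {G : SimpleGraph V} {k : ℕ}
    (hG : Constructible G k) (Q : Set V → Prop) (hsing : ∀ v, ¬ Q {v}) (hQ : Q Set.univ) :
    ∃ A B : Set V, IsCut G k A ∧ IsCut G k B ∧ IsCut G k (A ∪ B) ∧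
      Q (A ∪ B) ∧ ¬ Q A ∧ ¬ Q B := by
  obtain ⟨t, ⟨e⟩⟩ := hG
  have hr : Set.range e = Set.univ := e.surjective.range_eq
  refine exists_isCut_union_of_expr G Q hsing t e e.injective (fun _ _ => False)
    (fun x y _ => ?_) (fun x y _ w hw => absurd (hr ▸ Set.mem_univ w) hw) (hr ▸ hQ)
  simpa using e.map_adj_iff

/-! ### Every nonempty finite graph is constructible -/

lemma exists_expr_edgeless {n : ℕ} (S : Finset (Fin n)) (hS : S.Nonempty) :
    ∃ t : Expr n, Function.Injective t.label ∧ Set.range t.label = S ∧ t.graph = ⊥ := by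
  induction hS using Finset.Nonempty.cons_induction with
  | singleton a =>
    refine ⟨.vertex a, fun _ _ _ => rfl, ?_, rfl⟩
    ext b; simp [Expr.label, eq_comm]
  | cons a s ha hs ih =>
    obtain ⟨t, hinj, hr, hg⟩ := ih
    have hne : ∀ v, t.label v ≠ a := by
      intro v hv
      have : t.label v ∈ (s : Set (Fin n)) := hr ▸ ⟨v, rfl⟩
      exact ha (by simpa [hv] using this)
    refine ⟨.union (.vertex a) t, ?_, ?_, ?_⟩
    · rintro (x | x) (y | y) h
      · rfl
      · exact absurd h.symm (hne y)
      · exact absurd h (hne x)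
      · exact congrArg _ (hinj h)
    · have : Set.range (Expr.union (.vertex a) t).label = {a} ∪ Set.range t.label := by
        ext b; simp [Expr.label, eq_comm]
      rw [this, hr]
      simp
    · ext x y
      rcases x with x | x <;> rcases y with y | y <;> simp [Expr.graph, hg]

lemma exists_expr_of_edges {n : ℕ} (hn : 0 < n) (E : Finset (Fin n × Fin n)) :
    ∃ t : Expr n, Function.Bijective t.label ∧
      ∀ u v, t.graph.Adj u v ↔
        u ≠ v ∧ ((t.label u, t.label v) ∈ E ∨ (t.label v, t.label u) ∈ E) := by
  induction E using Finset.induction_on with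
  | empty =>
    obtain ⟨t, h1, h2, h3⟩ := exists_expr_edgeless (Finset.univ : Finset (Fin n)) ⟨⟨0, hn⟩, by simp⟩
    refine ⟨t, ⟨h1, Set.range_eq_univ.1 (by simpa using h2)⟩, by simp [h3]⟩
  | insert p E _ ih =>
    obtain ⟨t, hb, hadj⟩ := ih
    obtain ⟨i, j⟩ := p
    by_cases hij : i = j
    · refine ⟨t, hb, fun u v => ?_⟩
      rw [hadj]
      subst hij
      have := hb.1 (a₁ := u) (a₂ := v)
      simp only [Finset.mem_insert, Prod.mk.injEq]
      constructor
      · tauto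
      · rintro ⟨h, h'⟩
        refine ⟨h, ?_⟩
        have hne : ¬ (t.label u = i ∧ t.label v = i) := fun h'' => h (this (h''.1.trans h''.2.symm))
        tauto
    · refine ⟨.join i j hij t, hb, fun u v => ?_⟩
      simp only [Expr.graph, Expr.label, SimpleGraph.sup_adj, SimpleGraph.fromRel_adj, hadj,
        Finset.mem_insert, Prod.mk.injEq]
      tauto

/-- One label per vertex suffices. This matters because `sInf ∅ = 0`: without it, `cliqueWidth` need
not be an attained minimum. -/
lemma constructible_of_finite {V : Type} [Finite V] [Nonempty V] (G : SimpleGraph V) :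
    ∃ k, Constructible G k := by
  classical
  have := Fintype.ofFinite V
  let e := Fintype.equivFin V
  obtain ⟨t, hb, hadj⟩ := exists_expr_of_edges (n := Fintype.card V) Fintype.card_pos
    (Finset.univ.filter fun p => G.Adj (e.symm p.1) (e.symm p.2))
  refine ⟨_, t, ⟨(Equiv.ofBijective _ hb).trans e.symm, ?_⟩⟩
  intro u v
  simp only [Equiv.trans_apply, Equiv.ofBijective_apply, hadj, Finset.mem_filter,
    Finset.mem_univ, true_and, G.adj_comm (e.symm (t.label v)), or_self]
  refine ⟨fun h => ⟨?_, h⟩, fun h => h.2⟩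
  rintro rfl
  exact h.ne rfl

lemma constructible_cliqueWidth {V : Type} [Finite V] [Nonempty V] (G : SimpleGraph V) :
    Constructible G (cliqueWidth G) :=
  Nat.sInf_mem (constructible_of_finite G)

/-! ### Adjacency in the complemented walls -/

/-- All ends of the edge `e` of a wall lie in one column. -/
def IsVertical {h : ℕ} (e : (wall h).edgeSet) : Prop := ∀ p ∈ e.val, ∀ q ∈ e.val, p.x = q.x

/-- All ends of the edge `e` of a wall lie in one row. -/
def IsHorizontal {h : ℕ} (e : (wall h).edgeSet) : Prop := ∀ p ∈ e.val, ∀ q ∈ e.val, p.y = q.y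

lemma WallVert.ext_iff' {h : ℕ} {p q : WallVert h} : p = q ↔ p.x = q.x ∧ p.y = q.y := by
  constructor
  · rintro rfl; exact ⟨rfl, rfl⟩
  · rintro ⟨h1, h2⟩
    exact Subtype.ext (Prod.ext (Fin.ext h1) (Fin.ext h2))

lemma wall_adj {h : ℕ} {p q : WallVert h} : (wall h).Adj p q ↔
    (p.y = q.y ∧ (q.x = p.x + 1 ∨ p.x = q.x + 1)) ∨
    (p.x = q.x ∧ ((q.y = p.y + 1 ∧ Odd (p.x + p.y)) ∨ (p.y = q.y + 1 ∧ Odd (q.x + q.y)))) := by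
  simp only [wall, fromRel_adj, ne_eq, WallVert.ext_iff']
  constructor
  · rintro ⟨-, (⟨h1, h2⟩ | ⟨h1, h2⟩) | (⟨h1, h2⟩ | ⟨h1, h2⟩)⟩
    · exact Or.inl ⟨h1, Or.inl h2⟩
    · exact Or.inr ⟨h1, Or.inl h2⟩
    · exact Or.inl ⟨h1.symm, Or.inr h2⟩
    · exact Or.inr ⟨h1.symm, Or.inr h2⟩
  · rintro (⟨h1, h2 | h2⟩ | ⟨h1, h2 | h2⟩)
    · exact ⟨by omega, Or.inl (Or.inl ⟨h1, h2⟩)⟩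
    · exact ⟨by omega, Or.inr (Or.inl ⟨h1.symm, h2⟩)⟩
    · exact ⟨by omega, Or.inl (Or.inr ⟨h1, h2⟩)⟩
    · exact ⟨by omega, Or.inr (Or.inr ⟨h1.symm, h2⟩)⟩

lemma wall_adj_of_mem {h : ℕ} {e : (wall h).edgeSet} {p q : WallVert h} (hp : p ∈ e.val)
    (hq : q ∈ e.val) (hpq : p ≠ q) : (wall h).Adj p q := by
  obtain ⟨e, he⟩ := e
  have : e = s(p, q) := (Sym2.mem_and_mem_iff hpq).1 ⟨hp, hq⟩
  subst this
  exact he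

lemma edge_eq_of_mem {h : ℕ} {e f : (wall h).edgeSet} {p q : WallVert h} (hpq : p ≠ q)
    (hp : p ∈ e.val) (hq : q ∈ e.val) (hp' : p ∈ f.val) (hq' : q ∈ f.val) : e = f :=
  Subtype.ext (((Sym2.mem_and_mem_iff hpq).1 ⟨hp, hq⟩).trans
    ((Sym2.mem_and_mem_iff hpq).1 ⟨hp', hq'⟩).symm)

lemma exists_ends {h : ℕ} (e : (wall h).edgeSet) :
    ∃ p q : WallVert h, (wall h).Adj p q ∧ e.val = s(p, q) := by
  obtain ⟨e, he⟩ := e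
  induction e using Sym2.ind with
  | _ p q => exact ⟨p, q, he, rfl⟩

lemma isVertical_or_isHorizontal {h : ℕ} (e : (wall h).edgeSet) :
    IsVertical e ∨ IsHorizontal e := by
  obtain ⟨p, q, hpq, he⟩ := exists_ends e
  simp only [IsVertical, IsHorizontal, he, Sym2.mem_iff]
  rw [wall_adj] at hpq
  rcases hpq with ⟨h1, -⟩ | ⟨h1, -⟩
  · right; rintro a (rfl | rfl) b (rfl | rfl) <;> simp [h1]
  · left; rintro a (rfl | rfl) b (rfl | rfl) <;> simp [h1]

lemma not_isVertical_and_isHorizontal {h : ℕ} (e : (wall h).edgeSet) :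
    ¬ (IsVertical e ∧ IsHorizontal e) := by
  obtain ⟨p, q, hpq, he⟩ := exists_ends e
  rintro ⟨hv, hh⟩
  exact hpq.ne (WallVert.ext_iff'.2 ⟨hv p (by simp [he]) q (by simp [he]),
    hh p (by simp [he]) q (by simp [he])⟩)

lemma complementedWall_adj_inl_inl {h : ℕ} (p q : WallVert h) :
    (complementedWall h).graph.Adj (.inl p) (.inl q) ↔ p ≠ q := by
  simp [complementedWall, complementOn, subdivide, wallV1, wallV2, wallV3]

lemma complementedWall_adj_inl_inr {h : ℕ} (p : WallVert h) (e : (wall h).edgeSet) :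
    (complementedWall h).graph.Adj (.inl p) (.inr e) ↔ p ∈ e.val := by
  simp [complementedWall, complementOn, subdivide, wallV1, wallV2, wallV3]

lemma complementedWall_adj_inr_inr {h : ℕ} (e f : (wall h).edgeSet) :
    (complementedWall h).graph.Adj (.inr e) (.inr f) ↔
      e ≠ f ∧ ((IsVertical e ∧ IsVertical f) ∨ (IsHorizontal e ∧ IsHorizontal f)) := by
  have h1 := not_isVertical_and_isHorizontal e
  have h2 := not_isVertical_and_isHorizontal f
  have hV : ∀ e : (wall h).edgeSet, Sum.inr e ∈ wallV2 h ↔ IsVertical e := fun e => by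
    simp [wallV2, IsVertical]
  have hH : ∀ e : (wall h).edgeSet, Sum.inr e ∈ wallV3 h ↔ IsHorizontal e := fun e => by
    simp [wallV3, IsHorizontal]
  simp only [complementedWall, complementOn, hV, hH]
  simp [subdivide, wallV1]
  tauto

/-! ### Tracks: the rows and the zigzag columns of a wall -/

/-- The vertices of the subdivided wall that belong to the part of the wall where `g` takes the
value `i`. -/
def track {h : ℕ} (g : WallVert h → ℕ) (i : ℕ) : Set (WallVert h ⊕ (wall h).edgeSet) :=
  {a | (∃ p, a = .inl p ∧ g p = i) ∨ (∃ e, a = .inr e ∧ ∀ p ∈ e.val, g p = i)}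

@[simp] lemma inl_mem_track {h : ℕ} {g : WallVert h → ℕ} {i : ℕ} {p : WallVert h} :
    Sum.inl p ∈ track g i ↔ g p = i := by
  simp [track]

@[simp] lemma inr_mem_track {h : ℕ} {g : WallVert h → ℕ} {i : ℕ} {e : (wall h).edgeSet} :
    Sum.inr e ∈ track g i ↔ ∀ p ∈ e.val, g p = i := by
  simp [track]

/-- A set cuts another one if it contains some but not all of its elements. -/
def Cuts {α : Type} (A S : Set α) : Prop := (∃ a ∈ S, a ∈ A) ∧ ∃ b ∈ S, b ∉ A

/-- The part of the wall where `g` takes the value `i` is connected. -/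
def TrackConnected {h : ℕ} (g : WallVert h → ℕ) (i : ℕ) : Prop :=
  ∀ P : WallVert h → Prop, (∀ p q, g p = i → g q = i → (wall h).Adj p q → P p → P q) →
    ∀ p q, g p = i → g q = i → P p → P q

/-- If `A` separated no incident pair inside the track, membership in `A` would spread along its
wall edges to the whole track. -/
lemma exists_incident_of_cuts {h : ℕ} {g : WallVert h → ℕ} {i : ℕ} (hc : TrackConnected g i)
    {A : Set (WallVert h ⊕ (wall h).edgeSet)} (hA : Cuts A (track g i)) :
    ∃ (p : WallVert h) (e : (wall h).edgeSet), g p = i ∧ (∀ q ∈ e.val, g q = i) ∧ p ∈ e.val ∧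
      ¬ (Sum.inl p ∈ A ↔ Sum.inr e ∈ A) := by
  by_contra! hcon
  have hstep : ∀ p q, g p = i → g q = i → (wall h).Adj p q → Sum.inl p ∈ A → Sum.inl q ∈ A := by
    intro p q hp hq hpq hpA
    have he : ∀ r ∈ s(p, q), g r = i := by
      intro r hr
      rcases Sym2.mem_iff.1 hr with rfl | rfl <;> assumption
    have e1 := hcon p ⟨s(p, q), hpq⟩ hp he (by simp)
    have e2 := hcon q ⟨s(p, q), hpq⟩ hq he (by simp)
    exact e2.2 (e1.1 hpA)
  have hall := hc (fun p => Sum.inl p ∈ A) hstep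
  have hrep : ∀ a ∈ track g i, ∃ p, g p = i ∧ (a ∈ A ↔ Sum.inl p ∈ A) := by
    rintro (p | e) ha
    · exact ⟨p, by simpa using ha, Iff.rfl⟩
    · obtain ⟨p, q, -, he⟩ := exists_ends e
      rw [inr_mem_track] at ha
      have hp : p ∈ e.val := by simp [he]
      exact ⟨p, ha p hp, (hcon p e (ha p hp) ha hp).symm⟩
  obtain ⟨⟨a, ha, haA⟩, b, hb, hbA⟩ := hA
  obtain ⟨p, hp, hpa⟩ := hrep a ha
  obtain ⟨q, hq, hqb⟩ := hrep b hb
  exact hbA (hqb.2 (hall p q hp hq (hpa.1 haA)))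

-- Charge each split track to the label of the element of `A` in a separated incident pair, together
-- with the kind of that element (wall vertex or edge). If two tracks had the same charge, the two
-- elements of `A` would share their neighbours outside `A`, giving an incidence between different
-- tracks. Hence at most `2 * k` charges.
open Classical in
lemma card_cuts_track_le {h k : ℕ} {g : WallVert h → ℕ} {I : Finset ℕ}
    (hc : ∀ i ∈ I, TrackConnected g i) {A : Set (WallVert h ⊕ (wall h).edgeSet)}
    (hA : IsCut (complementedWall h).graph k A) :
    (I.filter fun i => Cuts A (track g i)).card ≤ 2 * k := by
  obtain ⟨l, hl⟩ := hA
  have hcard : (Finset.univ : Finset (Fin k × Bool)).card = 2 * k := by simp [mul_comm]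
  rw [← hcard]
  refine Finset.card_le_card_of_forall_subsingleton (fun i x =>
      ∃ (p : WallVert h) (e : (wall h).edgeSet), g p = i ∧ (∀ q ∈ e.val, g q = i) ∧ p ∈ e.val ∧
        ((Sum.inl p ∈ A ∧ Sum.inr e ∉ A ∧ x = (l (.inl p), true)) ∨
          (Sum.inr e ∈ A ∧ Sum.inl p ∉ A ∧ x = (l (.inr e), false)))) (fun i hi => ?_) ?_
  · rw [Finset.mem_filter] at hi
    obtain ⟨p, e, hp, he, hpe, hn⟩ := exists_incident_of_cuts (hc i hi.1) hi.2
    by_cases hpA : Sum.inl p ∈ A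
    · exact ⟨_, Finset.mem_univ _, p, e, hp, he, hpe, Or.inl ⟨hpA, by tauto, rfl⟩⟩
    · exact ⟨_, Finset.mem_univ _, p, e, hp, he, hpe, Or.inr ⟨by tauto, hpA, rfl⟩⟩
  rintro x - i ⟨-, p, e, hp, he, hpe, h1⟩ j ⟨-, p', e', hp', he', hpe', h2⟩
  rcases h1 with ⟨a1, a2, a3⟩ | ⟨a1, a2, a3⟩ <;> rcases h2 with ⟨b1, b2, b3⟩ | ⟨b1, b2, b3⟩
  · have hll : l (.inl p) = l (.inl p') := by
      exact congrArg Prod.fst (a3.symm.trans b3)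
    have := hl _ a1 _ b1 hll _ a2 ((complementedWall_adj_inl_inr _ _).2 hpe)
    exact (he _ ((complementedWall_adj_inl_inr _ _).1 this)).symm.trans hp'
  · simpa using congrArg Prod.snd (a3.symm.trans b3)
  · simpa using congrArg Prod.snd (a3.symm.trans b3)
  · have hll : l (.inr e) = l (.inr e') := by
      exact congrArg Prod.fst (a3.symm.trans b3)
    have := hl _ a1 _ b1 hll _ a2 ((complementedWall_adj_inl_inr _ _).2 hpe).symm
    exact hp.symm.trans (he' _ ((complementedWall_adj_inl_inr _ _).1 this.symm))

/-- The point `(x, y)` of an inner row or column. -/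
def wallPt {h : ℕ} (x y : ℕ) (hx : x < 2 * h + 2) (hy : y < h + 1)
    (hxy : (1 ≤ y ∧ y < h) ∨ (1 ≤ x ∧ x < 2 * h + 1)) : WallVert h :=
  ⟨(⟨x, hx⟩, ⟨y, hy⟩), by
    constructor
    · simp only [not_and]; omega
    · simp only [not_and]; split_ifs <;> omega⟩

/-- The potential `μ` leads every vertex of the track down to the root `o`. -/
lemma trackConnected_of_step {h : ℕ} {g : WallVert h → ℕ} {i : ℕ} (o : WallVert h)
    (μ : WallVert h → ℕ) (ho : ∀ p, g p = i → μ p = 0 → p = o)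
    (hstep : ∀ p, g p = i → μ p ≠ 0 → ∃ q, g q = i ∧ (wall h).Adj p q ∧ μ q < μ p) :
    TrackConnected g i := by
  intro P hP
  have key : ∀ n p, μ p = n → g p = i → (P p ↔ P o) := by
    intro n
    induction n using Nat.strong_induction_on with
    | _ n ih =>
      intro p hn hp
      by_cases h0 : μ p = 0
      · rw [ho p hp h0]
      · obtain ⟨q, hq, hpq, hlt⟩ := hstep p hp h0
        rw [← ih _ (hn ▸ hlt) q rfl hq]
        exact ⟨hP p q hp hq hpq, hP q p hq hp hpq.symm⟩
  intro p q hp hq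
  rw [key _ p rfl hp, key _ q rfl hq]
  exact id

lemma trackConnected_row {h r : ℕ} (h1 : 1 ≤ r) (h2 : r < h) :
    TrackConnected (WallVert.y (h := h)) r := by
  refine trackConnected_of_step (wallPt 0 r (by omega) (by omega) (by omega)) WallVert.x
    (fun p hp h0 => WallVert.ext_iff'.2 ⟨h0, hp⟩) (fun p hp h0 => ?_)
  have hx : p.x < 2 * h + 2 := p.1.1.2
  refine ⟨wallPt (p.x - 1) r (by omega) (by omega) (by omega), rfl, wall_adj.2 (Or.inl ?_), ?_⟩
  · exact ⟨hp, Or.inr (by change p.x = p.x - 1 + 1; omega)⟩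
  · change p.x - 1 < p.x; omega

lemma trackConnected_column {h i : ℕ} (h1 : 1 ≤ i) (h2 : i < h) :
    TrackConnected (fun p : WallVert h => p.x / 2) i := by
  refine trackConnected_of_step (wallPt (2 * i) 0 (by omega) (by omega) (by omega))
    -- This potential is the position on the zigzag path: an even `x + y` allows a step down, an odd
    -- one a step to the other half of the column.
    (fun p => 2 * p.y + (p.x + p.y) % 2) (fun p hp h0 => ?_) (fun p hp h0 => ?_)
  · refine WallVert.ext_iff'.2 ⟨?_, ?_⟩
    · change p.x = 2 * i; omega
    · change p.y = 0; omega
  · have hy : p.y < h + 1 := p.1.2.2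
    by_cases hpar : (p.x + p.y) % 2 = 0
    · refine ⟨wallPt p.x (p.y - 1) (by omega) (by omega) (by omega), hp,
        wall_adj.2 (Or.inr ⟨rfl, Or.inr ⟨?_, ?_⟩⟩), ?_⟩
      · change p.y = p.y - 1 + 1; omega
      · rw [Nat.odd_iff]; change (p.x + (p.y - 1)) % 2 = 1; omega
      · change 2 * (p.y - 1) + (p.x + (p.y - 1)) % 2 < 2 * p.y + (p.x + p.y) % 2; omega
    · by_cases hx : p.x = 2 * i
      · refine ⟨wallPt (2 * i + 1) p.y (by omega) (by omega) (by omega), ?_,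
          wall_adj.2 (Or.inl ⟨rfl, Or.inl ?_⟩), ?_⟩
        · change (2 * i + 1) / 2 = i; omega
        · change 2 * i + 1 = p.x + 1; omega
        · change 2 * p.y + (2 * i + 1 + p.y) % 2 < 2 * p.y + (p.x + p.y) % 2; omega
      · refine ⟨wallPt (2 * i) p.y (by omega) (by omega) (by omega), ?_,
          wall_adj.2 (Or.inl ⟨rfl, Or.inr ?_⟩), ?_⟩
        · change (2 * i) / 2 = i; omega
        · change p.x = 2 * i + 1; omega
        · change 2 * p.y + (2 * i + p.y) % 2 < 2 * p.y + (p.x + p.y) % 2; omega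

/-! ### The lower bound on the clique-width of complemented walls -/

lemma le_of_constructible_complementedWall {h k : ℕ}
    (hk : Constructible (complementedWall h).graph k) : h ≤ 4 * k + 1 := by
  classical
  by_contra! hlt
  let Q : Set (WallVert h ⊕ (wall h).edgeSet) → Prop :=
    fun A => ∃ r, 1 ≤ r ∧ r < h ∧ track (WallVert.y (h := h)) r ⊆ A
  have hsing : ∀ v, ¬ Q {v} := by
    rintro v ⟨r, h1, h2, hr⟩
    have e1 : Sum.inl (wallPt 0 r (by omega) (by omega) (by omega)) = v :=
      hr (inl_mem_track.2 (rfl : WallVert.y (wallPt 0 r _ _ _) = r))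
    have e2 : Sum.inl (wallPt 1 r (by omega) (by omega) (by omega)) = v :=
      hr (inl_mem_track.2 (rfl : WallVert.y (wallPt 1 r _ _ _) = r))
    have := (WallVert.ext_iff'.1 (Sum.inl_injective (e1.trans e2.symm))).1
    exact absurd this (by change ¬ (0 = 1); omega)
  obtain ⟨A, B, hA, -, hAB, ⟨r, hr1, hr2, hr⟩, hQA, hQB⟩ :=
    Constructible.exists_isCut_union (V := WallVert h ⊕ (wall h).edgeSet) hk Q hsing
      ⟨1, le_rfl, by omega, Set.subset_univ _⟩
  have hrow : ∀ i ∈ Finset.Ico 1 h, TrackConnected (WallVert.y (h := h)) i := fun i hi =>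
    trackConnected_row (Finset.mem_Ico.1 hi).1 (Finset.mem_Ico.1 hi).2
  have hcol : ∀ i ∈ Finset.Ico 1 h, TrackConnected (fun p : WallVert h => p.x / 2) i :=
    fun i hi => trackConnected_column (Finset.mem_Ico.1 hi).1 (Finset.mem_Ico.1 hi).2
  have c1 := card_cuts_track_le hrow hA
  have c2 := card_cuts_track_le hrow hAB
  have c3 := card_cuts_track_le hcol hAB
  have hcard : (Finset.Ico 1 h).card = h - 1 := by simp
  -- At most `2 * k` of the `h - 1 > 4 * k` inner columns are split by `A ∪ B`.
  obtain ⟨j, hj, hjc⟩ : ∃ j ∈ Finset.Ico 1 h,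
      ¬ Cuts (A ∪ B) (track (fun p : WallVert h => p.x / 2) j) := by
    by_contra! hcon
    rw [Finset.filter_true_of_mem hcon, hcard] at c3
    omega
  have hj' := Finset.mem_Ico.1 hj
  have hcross : ∀ i (_ : 1 ≤ i) (_ : i < h), ∃ p : WallVert h, p.x / 2 = j ∧ p.y = i :=
    fun i h1 h2 => ⟨wallPt (2 * j) i (by omega) (by omega) (by omega),
      by change 2 * j / 2 = j; omega, rfl⟩
  have hcolA : track (fun p : WallVert h => p.x / 2) j ⊆ A ∪ B := by
    intro a ha
    by_contra hna
    obtain ⟨p, hp, hpr⟩ := hcross r hr1 hr2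
    exact hjc ⟨⟨.inl p, inl_mem_track.2 hp, hr (inl_mem_track.2 hpr)⟩, a, ha, hna⟩
  -- Each inner row crosses column `j`, hence meets `A ∪ B`. If neither set split it, it would lie
  -- in `A ∪ B` and, not being inside `A`, would avoid `A` and lie in `B`.
  have hsub : Finset.Ico 1 h ⊆
      ((Finset.Ico 1 h).filter fun i => Cuts A (track WallVert.y i)) ∪
      ((Finset.Ico 1 h).filter fun i => Cuts (A ∪ B) (track WallVert.y i)) := by
    intro i hi
    have hi' := Finset.mem_Ico.1 hi
    simp only [Finset.mem_union, Finset.mem_filter, hi, true_and]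
    by_contra! hcon
    obtain ⟨hi1, hi2⟩ := hcon
    obtain ⟨p, hp, hpr⟩ := hcross i hi'.1 hi'.2
    have hall : track WallVert.y i ⊆ A ∪ B := by
      intro a ha
      by_contra hna
      exact hi2 ⟨⟨.inl p, inl_mem_track.2 hpr, hcolA (inl_mem_track.2 hp)⟩, a, ha, hna⟩
    have hnA : ∃ b ∈ track WallVert.y i, b ∉ A := by
      by_contra! hcon
      exact hQA ⟨i, hi'.1, hi'.2, hcon⟩
    refine hQB ⟨i, hi'.1, hi'.2, fun a ha => ?_⟩
    rcases hall ha with haA | haB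
    · exact absurd ⟨⟨a, ha, haA⟩, hnA⟩ hi1
    · exact haB
  have := (Finset.card_le_card hsub).trans (Finset.card_union_le _ _)
  rw [hcard] at this
  omega

theorem hasUnboundedCliqueWidth_complementedWall :
    HasUnboundedCliqueWidth {G | ∃ h : ℕ, 1 ≤ h ∧ G = complementedWall h} := by
  rintro ⟨c, hc⟩
  have h1 := hc _ ⟨4 * c + 2, by omega, rfl⟩
  have : Finite (complementedWall (4 * c + 2)).V := (complementedWall _).finite
  have : Nonempty (complementedWall (4 * c + 2)).V :=
    ⟨.inl (wallPt 0 1 (by omega) (by omega) (by omega))⟩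
  have h2 := le_of_constructible_complementedWall
    (constructible_cliqueWidth (complementedWall (4 * c + 2)).graph)
  omega

/-! ### The local structure of complemented walls -/

/-- The local structure of complemented walls: the vertices coloured `0` are the vertices of the
wall, those coloured `1` and `2` its vertical and its horizontal edges, `par` is a proper
2-colouring of the wall, and `port u e` is the direction in which the edge `e` leaves `u`. -/
structure WallLike {V : Type} (G : SimpleGraph V) (c : V → Fin 3) (par : V → Bool)
    (port : V → V → Fin 3) : Prop where
  adj_of_eq : ∀ u v, u ≠ v → c u = c v → G.Adj u v
  not_adj : ∀ u v, c u = 1 → c v = 2 → ¬ G.Adj u v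
  par_ne : ∀ e u v, c e ≠ 0 → c u = 0 → c v = 0 → G.Adj e u → G.Adj e v → u ≠ v →
    par u ≠ par v
  edge_unique : ∀ e f u v, c e ≠ 0 → c f ≠ 0 → c u = 0 → c v = 0 → u ≠ v →
    G.Adj e u → G.Adj e v → G.Adj f u → G.Adj f v → e = f
  port_inj : ∀ u e f, c u = 0 → c e ≠ 0 → c f ≠ 0 → G.Adj u e → G.Adj u f →
    port u e = port u f → e = f
  port_eq_two : ∀ u e, c u = 0 → c e ≠ 0 → G.Adj u e → (port u e = 2 ↔ c e = 1)

lemma WallLike.comap {V W : Type} {G : SimpleGraph V} {H : SimpleGraph W} {c : V → Fin 3}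
    {par : V → Bool} {port : V → V → Fin 3} (hG : WallLike G c par port) (f : H ↪g G) :
    WallLike H (c ∘ f) (par ∘ f) (fun u v => port (f u) (f v)) where
  adj_of_eq _ _ huv hc := f.map_adj_iff.1 (hG.adj_of_eq _ _ (f.injective.ne huv) hc)
  not_adj _ _ hu hv h := hG.not_adj _ _ hu hv (f.map_adj_iff.2 h)
  par_ne _ _ _ he hu hv h1 h2 huv := hG.par_ne _ _ _ he hu hv (f.map_adj_iff.2 h1)
    (f.map_adj_iff.2 h2) (f.injective.ne huv)
  edge_unique _ _ _ _ he hf hu hv huv h1 h2 h3 h4 := f.injective <|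
    hG.edge_unique _ _ _ _ he hf hu hv (f.injective.ne huv) (f.map_adj_iff.2 h1)
      (f.map_adj_iff.2 h2) (f.map_adj_iff.2 h3) (f.map_adj_iff.2 h4)
  port_inj _ _ _ hu he hf h1 h2 h := f.injective <|
    hG.port_inj _ _ _ hu he hf (f.map_adj_iff.2 h1) (f.map_adj_iff.2 h2) h
  port_eq_two _ _ hu he h := hG.port_eq_two _ _ hu he (f.map_adj_iff.2 h)

lemma exists_other_end {h : ℕ} {e : (wall h).edgeSet} {p : WallVert h} (hp : p ∈ e.val) :
    ∃ q ∈ e.val, q ≠ p ∧ (wall h).Adj p q := by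
  obtain ⟨a, b, hab, he⟩ := exists_ends e
  rw [he, Sym2.mem_iff] at hp
  rcases hp with rfl | rfl
  · exact ⟨b, by simp [he], hab.ne', hab⟩
  · exact ⟨a, by simp [he], hab.ne, hab.symm⟩

open Classical in
lemma exists_wallLike_complementedWall (h : ℕ) :
    ∃ c par port, WallLike (complementedWall h).graph c par port := by
  let c : WallVert h ⊕ (wall h).edgeSet → Fin 3 :=
    Sum.elim (fun _ => 0) (fun e => if IsVertical e then 1 else 2)
  let par : WallVert h ⊕ (wall h).edgeSet → Bool :=
    Sum.elim (fun p => decide ((p.x + p.y) % 2 = 0)) (fun _ => true)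
  -- Ports: 0 is right, 1 is left, 2 is vertical. Parity allows only one vertical edge at a vertex.
  -- Other arguments get junk values.
  let port : WallVert h ⊕ (wall h).edgeSet → WallVert h ⊕ (wall h).edgeSet → Fin 3 :=
    Sum.elim (fun p => Sum.elim (fun _ => 0) (fun e => if IsVertical e then 2 else
      if ∃ q ∈ e.val, q.x = p.x + 1 then 0 else 1)) (fun _ _ => 0)
  have cl : ∀ p, c (.inl p) = 0 := fun _ => rfl
  have cr : ∀ e, c (.inr e) ≠ 0 := fun e => by
    simp only [c, Sum.elim_inr]; split_ifs <;> simp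
  have cv : ∀ e, c (.inr e) = 1 ↔ IsVertical e := fun e => by
    simp only [c, Sum.elim_inr]; split_ifs <;> simp [*]
  have ch : ∀ e, c (.inr e) = 2 ↔ IsHorizontal e := fun e => by
    have h1 := isVertical_or_isHorizontal e
    have h2 := not_isVertical_and_isHorizontal e
    simp only [c, Sum.elim_inr]; split_ifs <;> simp <;> tauto
  have il := fun p e => (complementedWall_adj_inl_inr (h := h) p e).1
  refine ⟨c, par, port, ?_, ?_, ?_, ?_, ?_, ?_⟩
  · rintro (p | e) (q | f) hne hc
    · exact (complementedWall_adj_inl_inl _ _).2 (fun h => hne (congrArg _ h))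
    · exact absurd hc.symm (cr f)
    · exact absurd hc (cr e)
    · refine (complementedWall_adj_inr_inr _ _).2 ⟨fun h => hne (congrArg _ h), ?_⟩
      rcases isVertical_or_isHorizontal e with he | he
      · exact Or.inl ⟨he, (cv f).1 (hc ▸ (cv e).2 he)⟩
      · exact Or.inr ⟨he, (ch f).1 (hc ▸ (ch e).2 he)⟩
  · rintro (p | e) (q | f) h1 h2 hadj
    · simp [cl] at h1
    · simp [cl] at h1
    · simp [cl] at h2
    · have e1 := (cv e).1 h1
      have e2 := (ch f).1 h2
      rcases ((complementedWall_adj_inr_inr _ _).1 hadj).2 with ⟨-, h3⟩ | ⟨h3, -⟩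
      · exact not_isVertical_and_isHorizontal f ⟨h3, e2⟩
      · exact not_isVertical_and_isHorizontal e ⟨e1, h3⟩
  · rintro (p | e) (u | u) (v | v) he hu hv h1 h2 huv
    any_goals first | exact absurd hu (cr _) | exact absurd hv (cr _) | exact absurd (cl _) he
    have hadj := wall_adj_of_mem (il _ _ h1.symm) (il _ _ h2.symm) (fun h => huv (congrArg _ h))
    simp only [par, Sum.elim_inl, ne_eq, decide_eq_decide]
    rw [wall_adj] at hadj
    simp only [Nat.odd_iff] at hadj
    omega
  · rintro (p | e) (q | f) (u | u) (v | v) he hf hu hv huv h1 h2 h3 h4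
    any_goals first | exact absurd hu (cr _) | exact absurd hv (cr _) | exact absurd (cl _) he |
      exact absurd (cl _) hf
    exact congrArg _ (edge_eq_of_mem (fun h => huv (congrArg _ h)) (il _ _ h1.symm)
      (il _ _ h2.symm) (il _ _ h3.symm) (il _ _ h4.symm))
  · rintro (u | u) (p | e) (q | f) hu he hf h1 h2 hport
    any_goals first | exact absurd hu (cr _) | exact absurd (cl _) he | exact absurd (cl _) hf
    obtain ⟨a, ha, hau, hadja⟩ := exists_other_end (il _ _ h1)
    obtain ⟨b, hb, hbu, hadjb⟩ := exists_other_end (il _ _ h2)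
    suffices hab : a = b by
      subst hab
      exact congrArg _ (edge_eq_of_mem hau ha (il _ _ h1) hb (il _ _ h2))
    rw [wall_adj] at hadja hadjb
    simp only [Nat.odd_iff] at hadja hadjb
    rw [WallVert.ext_iff']
    have key : ∀ (e : (wall h).edgeSet) (a : WallVert h), a ∈ e.val → u ∈ e.val → a ≠ u →
        ((∃ q ∈ e.val, q.x = u.x + 1) ↔ a.x = u.x + 1) := by
      intro e a ha hu hau
      refine ⟨?_, fun h => ⟨a, ha, h⟩⟩
      rintro ⟨q, hq, hqx⟩
      rw [(Sym2.mem_and_mem_iff hau).1 ⟨ha, hu⟩, Sym2.mem_iff] at hq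
      rcases hq with rfl | rfl
      · exact hqx
      · omega
    simp only [port, Sum.elim_inl, Sum.elim_inr, key e a ha (il _ _ h1) hau,
      key f b hb (il _ _ h2) hbu] at hport
    have a1 := isVertical_or_isHorizontal e
    have a2 := isVertical_or_isHorizontal f
    by_cases he1 : IsVertical e <;> by_cases hf1 : IsVertical f
    · have := he1 a ha u (il _ _ h1)
      have := hf1 b hb u (il _ _ h2)
      omega
    · rw [if_pos he1, if_neg hf1] at hport
      split_ifs at hport <;> exact absurd hport (by decide)
    · rw [if_neg he1, if_pos hf1] at hport
      split_ifs at hport <;> exact absurd hport (by decide)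
    · have := (a1.resolve_left he1) a ha u (il _ _ h1)
      have := (a2.resolve_left hf1) b hb u (il _ _ h2)
      rw [if_neg he1, if_neg hf1] at hport
      split_ifs at hport <;> omega
  · rintro (u | u) (p | e) hu he h1
    any_goals first | exact absurd hu (cr _) | exact absurd (cl _) he
    rw [cv]
    simp only [port, Sum.elim_inl, Sum.elim_inr]
    split_ifs <;> simp [*]

/-! ### Forbidden induced subgraphs of small size -/

section

variable {V : Type} {G : SimpleGraph V} {c : V → Fin 3} {par : V → Bool} {port : V → V → Fin 3}

lemma WallLike.injOn_of_independent (hG : WallLike G c par port) {s : Set V}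
    (hs : ∀ u ∈ s, ∀ v ∈ s, ¬ G.Adj u v) : Set.InjOn c s := by
  intro u hu v hv huv
  by_contra hne
  exact hs u hu v hv (hG.adj_of_eq u v hne huv)

lemma WallLike.not_fourP1 (hG : WallLike G c par port) : ¬ fourP1.graph.IsIndContained G := by
  rintro ⟨f⟩
  have h := (hG.comap f).injOn_of_independent (s := Set.univ)
    (fun _ _ _ _ => id)
  have := Fintype.card_le_of_injective (α := Fin 4) (β := Fin 3) _ (Set.injOn_univ.1 h)
  simp at this

lemma WallLike.eq_zero_or_eq (hG : WallLike G c par port) {u v : V} (hv : c v ≠ 0)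
    (h : G.Adj u v) : c u = 0 ∨ c u = c v := by
  have h1 := hG.not_adj u v
  have h2 := hG.not_adj v u
  rw [G.adj_comm v u] at h2
  have key : ∀ a b : Fin 3, b ≠ 0 → a = 0 ∨ a = b ∨ (a = 1 ∧ b = 2) ∨ (b = 1 ∧ a = 2) := by
    decide
  have := key (c u) (c v) hv
  tauto

lemma WallLike.eq_zero_of_adj (hG : WallLike G c par port) {u v : V} (hv : c v ≠ 0)
    (h : G.Adj v u) (hne : c u ≠ c v) : c u = 0 :=
  (hG.eq_zero_or_eq hv h.symm).resolve_right hne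

/-- Each triangle vertex has colour 0 or that of `e`. Three of colour 0 would be ends of `e` with
pairwise different parities; with two, the third has the same two ends as `e`; with one, the other
two share two ends. With none, `d` has three edges of one kind: vertical ones share port 2, and
horizontal ones have only two ports. -/
lemma WallLike.not_triangle_of_zero (hG : WallLike G c par port) {d e t₁ t₂ t₃ : V}
    (hd : c d = 0) (he : c e ≠ 0)
    (h12 : G.Adj t₁ t₂) (h13 : G.Adj t₁ t₃) (h23 : G.Adj t₂ t₃)
    (d1 : G.Adj t₁ d) (d2 : G.Adj t₂ d) (d3 : G.Adj t₃ d)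
    (e1 : G.Adj t₁ e) (e2 : G.Adj t₂ e) (e3 : G.Adj t₃ e) : False := by
  have two : ∀ s s' t, G.Adj s s' → G.Adj s t → G.Adj s' t → G.Adj t d → G.Adj s e → G.Adj s' e →
      G.Adj t e → c s = 0 → c s' = 0 → c t = c e → False := by
    intro s s' t h1 h2 h3 h4 h5 h6 h7 hs hs' ht
    exact h7.ne (hG.edge_unique t e s s' (ht ▸ he) he hs hs' h1.ne h2.symm h3.symm h5.symm h6.symm)
  have one : ∀ s t t', G.Adj s t → G.Adj s t' → G.Adj t t' → G.Adj s d → G.Adj t d → G.Adj t' d →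
      c s = 0 → c t = c e → c t' = c e → False := by
    intro s t t' h1 h2 h3 h4 h5 h6 hs ht ht'
    exact h3.ne (hG.edge_unique t t' s d (ht ▸ he) (ht' ▸ he) hs hd h4.ne h1.symm h5 h2.symm h6)
  rcases hG.eq_zero_or_eq he e1 with c1 | c1 <;> rcases hG.eq_zero_or_eq he e2 with c2 | c2 <;>
    rcases hG.eq_zero_or_eq he e3 with c3 | c3
  · have p12 := hG.par_ne e _ _ he c1 c2 e1.symm e2.symm h12.ne
    have p13 := hG.par_ne e _ _ he c1 c3 e1.symm e3.symm h13.ne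
    have p23 := hG.par_ne e _ _ he c2 c3 e2.symm e3.symm h23.ne
    revert p12 p13 p23
    cases par t₁ <;> cases par t₂ <;> cases par t₃ <;> simp
  · exact two _ _ _ h12 h13 h23 d3 e1 e2 e3 c1 c2 c3
  · exact two _ _ _ h13 h12 h23.symm d2 e1 e3 e2 c1 c3 c2
  · exact one _ _ _ h12 h13 h23 d1 d2 d3 c1 c2 c3
  · exact two _ _ _ h23 h12.symm h13.symm d1 e2 e3 e1 c2 c3 c1
  · exact one _ _ _ h12.symm h23 h13 d2 d1 d3 c2 c1 c3
  · exact one _ _ _ h13.symm h23.symm h12 d3 d1 d2 c3 c1 c2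
  · have n1 : c t₁ ≠ 0 := c1 ▸ he
    have n2 : c t₂ ≠ 0 := c2 ▸ he
    have n3 : c t₃ ≠ 0 := c3 ▸ he
    have p12 := fun h => h12.ne (hG.port_inj d _ _ hd n1 n2 d1.symm d2.symm h)
    have p13 := fun h => h13.ne (hG.port_inj d _ _ hd n1 n3 d1.symm d3.symm h)
    have p23 := fun h => h23.ne (hG.port_inj d _ _ hd n2 n3 d2.symm d3.symm h)
    have q1 := hG.port_eq_two d _ hd n1 d1.symm
    have q2 := hG.port_eq_two d _ hd n2 d2.symm
    have q3 := hG.port_eq_two d _ hd n3 d3.symm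
    rw [c1] at q1; rw [c2] at q2; rw [c3] at q3
    have key : ∀ x y z : Fin 3, x ≠ y → x ≠ z → y ≠ z → x = 2 ∨ y = 2 ∨ z = 2 := by decide
    have key' := key _ _ _ p12 p13 p23
    by_cases h : c e = 1
    · exact p12 ((q1.2 h).trans (q2.2 h).symm)
    · tauto

lemma WallLike.not_triangle_of_one_two (hG : WallLike G c par port) {d e t₁ t₂ : V}
    (hd : c d = 1) (he : c e = 2) (h12 : G.Adj t₁ t₂)
    (d1 : G.Adj t₁ d) (d2 : G.Adj t₂ d)
    (e1 : G.Adj t₁ e) (e2 : G.Adj t₂ e) : False := by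
  have h0 : ∀ t, G.Adj t d → G.Adj t e → c t = 0 := by
    intro t h1 h2
    have a1 := hG.eq_zero_or_eq (by simp [hd]) h1
    have a2 := hG.eq_zero_or_eq (by simp [he]) h2
    rcases a1 with a1 | a1
    · exact a1
    · rcases a2 with a2 | a2
      · exact a2
      · rw [a1, hd, he] at a2; exact absurd a2 (by decide)
  have := hG.edge_unique d e t₁ t₂ (by simp [hd]) (by simp [he]) (h0 _ d1 e1) (h0 _ d2 e2) h12.ne
    d1.symm d2.symm e1.symm e2.symm
  rw [this, he] at hd
  exact absurd hd (by decide)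

lemma WallLike.not_coThreeP1AddP2 (hG : WallLike G c par port) :
    ¬ coThreeP1AddP2.graph.IsIndContained G := by
  rintro ⟨f⟩
  have hT : ∀ i j : Fin 3, i ≠ j → G.Adj (f (.inl i)) (f (.inl j)) := fun i j hij =>
    f.map_adj_iff.2 (by simp [coThreeP1AddP2, hij])
  have hS : ∀ (i : Fin 3) (j : Fin 2), G.Adj (f (.inl i)) (f (.inr j)) := fun i j =>
    f.map_adj_iff.2 (by simp [coThreeP1AddP2])
  have hn : ¬ G.Adj (f (.inr 0)) (f (.inr 1)) := fun h => by
    have := f.map_adj_iff.1 h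
    simp [coThreeP1AddP2, pathGraph_adj] at this
  have hne : f (.inr 0) ≠ f (.inr 1) := f.injective.ne (Sum.inr_injective.ne (by decide))
  have hc : c (f (.inr 0)) ≠ c (f (.inr 1)) := fun h => hn (hG.adj_of_eq _ _ hne h)
  have key : ∀ a b : Fin 3, a ≠ b → (a = 0 ∧ b ≠ 0) ∨ (b = 0 ∧ a ≠ 0) ∨ (a = 1 ∧ b = 2) ∨
    (b = 1 ∧ a = 2) := by decide
  have h12 := hT 0 1 (by decide)
  have h13 := hT 0 2 (by decide)
  have h23 := hT 1 2 (by decide)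
  rcases key _ _ hc with ⟨h1, h2⟩ | ⟨h1, h2⟩ | ⟨h1, h2⟩ | ⟨h1, h2⟩
  · exact hG.not_triangle_of_zero h1 h2 h12 h13 h23 (hS _ _) (hS _ _) (hS _ _) (hS _ _) (hS _ _)
      (hS _ _)
  · exact hG.not_triangle_of_zero h1 h2 h12 h13 h23 (hS _ _) (hS _ _) (hS _ _)
      (hS _ _) (hS _ _) (hS _ _)
  · exact hG.not_triangle_of_one_two h1 h2 h12 (hS _ _) (hS _ _) (hS _ _) (hS _ _)
  · exact hG.not_triangle_of_one_two h1 h2 h12 (hS _ _) (hS _ _) (hS _ _) (hS _ _)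

/-- Colour classes are cliques, so the colouring splits the 5-cycle into two edges and a vertex. Any
two of these parts are adjacent, including the parts of colours 1 and 2. -/
lemma WallLike.not_cycle_five (hG : WallLike G c par port) {v₀ v₁ v₂ v₃ v₄ : V}
    (h01 : G.Adj v₀ v₁) (h12 : G.Adj v₁ v₂) (h23 : G.Adj v₂ v₃) (h34 : G.Adj v₃ v₄)
    (h40 : G.Adj v₄ v₀) (h02 : ¬ G.Adj v₀ v₂) (h03 : ¬ G.Adj v₀ v₃) (h13 : ¬ G.Adj v₁ v₃)
    (h14 : ¬ G.Adj v₁ v₄) (h24 : ¬ G.Adj v₂ v₄) : False := by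
  have hne : ∀ {u v w}, G.Adj u w → ¬ G.Adj v w → ¬ G.Adj u v → c u ≠ c v := by
    intro u v w h1 h2 h3 h4
    by_cases huv : u = v
    · exact h2 (huv ▸ h1)
    · exact h3 (hG.adj_of_eq u v huv h4)
  have hz : ∀ {u v}, G.Adj u v → ¬ (c u = 1 ∧ c v = 2) ∧ ¬ (c v = 1 ∧ c u = 2) := fun h =>
    ⟨fun h' => hG.not_adj _ _ h'.1 h'.2 h, fun h' => hG.not_adj _ _ h'.1 h'.2 h.symm⟩
  have key : ∀ a b c d e : Fin 3, a ≠ c → a ≠ d → b ≠ d → b ≠ e → c ≠ e →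
      (¬ (a = 1 ∧ b = 2) ∧ ¬ (b = 1 ∧ a = 2)) → (¬ (b = 1 ∧ c = 2) ∧ ¬ (c = 1 ∧ b = 2)) →
      (¬ (c = 1 ∧ d = 2) ∧ ¬ (d = 1 ∧ c = 2)) → (¬ (d = 1 ∧ e = 2) ∧ ¬ (e = 1 ∧ d = 2)) →
      ¬ (¬ (e = 1 ∧ a = 2) ∧ ¬ (a = 1 ∧ e = 2)) := by decide
  exact key _ _ _ _ _ (hne h40.symm h24 h02) (hne h01 (fun h => h13 h.symm) h03)
    (hne h01.symm (fun h => h03 h.symm) h13) (hne h12 (fun h => h24 h.symm) h14)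
    (hne h12.symm (fun h => h14 h.symm) h24)
    (hz h01) (hz h12) (hz h23) (hz h34) (hz h40)

end

/-! ### Self-complementary graphs in complemented walls -/

section

variable {V : Type} {G : SimpleGraph V}

lemma nonempty_iso_bull [Fintype V] (hcard : Fintype.card V = 5) {a b c d e : V}
    (hab : G.Adj a b) (hbc : G.Adj b c) (hcd : G.Adj c d) (hde : G.Adj d e) (hbd : G.Adj b d)
    (hac : ¬ G.Adj a c) (had : ¬ G.Adj a d) (hae : ¬ G.Adj a e) (hbe : ¬ G.Adj b e)
    (hce : ¬ G.Adj c e) : Nonempty (G ≃g bull) := by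
  have nac : a ≠ c := fun h => had (h ▸ hcd)
  have nad : a ≠ d := fun h => hae (h ▸ hde)
  have nae : a ≠ e := fun h => had (h ▸ hde.symm)
  have nbe : b ≠ e := fun h => hae (h ▸ hab)
  have nce : c ≠ e := fun h => hbe (h ▸ hbc)
  let f : Fin 5 → V := ![a, b, c, d, e]
  have hinj : Function.Injective f := by
    intro i j hij
    fin_cases i <;> fin_cases j <;> simp [f] at hij ⊢
    all_goals first
      | exact absurd hij nac | exact absurd hij.symm nac | exact absurd hij nad
      | exact absurd hij.symm nad | exact absurd hij nae | exact absurd hij.symm nae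
      | exact absurd hij nbe | exact absurd hij.symm nbe | exact absurd hij nce
      | exact absurd hij.symm nce | exact absurd hij hab.ne | exact absurd hij hab.ne'
      | exact absurd hij hbc.ne | exact absurd hij hbc.ne' | exact absurd hij hcd.ne
      | exact absurd hij hcd.ne' | exact absurd hij hde.ne | exact absurd hij hde.ne'
      | exact absurd hij hbd.ne | exact absurd hij hbd.ne'
  have hbij : Function.Bijective f :=
    (Fintype.bijective_iff_injective_and_card f).2 ⟨hinj, by simp [hcard]⟩
  have hca : ¬ G.Adj c a := fun h => hac h.symm
  have hda : ¬ G.Adj d a := fun h => had h.symm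
  have hea : ¬ G.Adj e a := fun h => hae h.symm
  have heb : ¬ G.Adj e b := fun h => hbe h.symm
  have hec : ¬ G.Adj e c := fun h => hce h.symm
  refine ⟨RelIso.symm ⟨Equiv.ofBijective f hbij, ?_⟩⟩
  intro i j
  simp only [Equiv.ofBijective_apply]
  fin_cases i <;> fin_cases j <;> simp [f, bull, hab, hbc, hcd, hde, hbd,
    hab.symm, hbc.symm, hcd.symm, hde.symm, hbd.symm, hac, had, hae, hbe, hce,
    hca, hda, hea, heb, hec]

-- Unless the permutation is a 4-cycle with a fixed point, some pair returns to itself after 1, 3 or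
-- 5 steps. For a complementing permutation this is absurd, since each step flips adjacency.
set_option maxRecDepth 100000 in
lemma perm_fin_five_cases : ∀ s : Equiv.Perm (Fin 5),
    (∃ x y, x ≠ y ∧ ((s x = y ∧ s y = x) ∨ (s (s (s x)) = x ∧ s (s (s y)) = y) ∨
      (s (s (s (s (s x)))) = x ∧ s (s (s (s (s y)))) = y))) ∨
    (∃ x z, s (s (s (s x))) = x ∧ s (s x) ≠ x ∧ s z = z) := by
  decide

lemma nonempty_iso_bull_of_card_eq_five [Fintype V] {c : V → Fin 3} {par : V → Bool}
    {port : V → V → Fin 3} (hG : WallLike G c par port) (hcard : Fintype.card V = 5)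
    (σ : Equiv.Perm V) (hσ : ∀ u v, u ≠ v → (G.Adj (σ u) (σ v) ↔ ¬ G.Adj u v)) :
    Nonempty (G ≃g bull) := by
  have hne : ∀ {u v}, u ≠ v → σ u ≠ σ v := fun h => σ.injective.ne h
  have hcases : (∃ x y, x ≠ y ∧ ((σ x = y ∧ σ y = x) ∨ (σ (σ (σ x)) = x ∧ σ (σ (σ y)) = y) ∨
      (σ (σ (σ (σ (σ x)))) = x ∧ σ (σ (σ (σ (σ y)))) = y))) ∨
      (∃ x z, σ (σ (σ (σ x))) = x ∧ σ (σ x) ≠ x ∧ σ z = z) := by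
    let φ := Fintype.equivFinOfCardEq hcard
    have h := perm_fin_five_cases (φ.permCongr σ)
    simp only [Equiv.permCongr_apply, Equiv.symm_apply_apply] at h
    rcases h with ⟨x, y, hxy, h⟩ | ⟨x, z, h1, h2, h3⟩
    · refine Or.inl ⟨φ.symm x, φ.symm y, φ.symm.injective.ne hxy, ?_⟩
      simpa only [Equiv.eq_symm_apply] using h
    · refine Or.inr ⟨φ.symm x, φ.symm z, ?_⟩
      simpa only [Equiv.eq_symm_apply, ne_eq] using ⟨h1, h2, h3⟩
  rcases hcases with ⟨x, y, hxy, ⟨h1, h2⟩ | ⟨h1, h2⟩ | ⟨h1, h2⟩⟩ | ⟨x, z, h1, h2, h3⟩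
  · have := hσ x y hxy
    rw [h1, h2, G.adj_comm] at this
    tauto
  · have e1 := hσ x y hxy
    have e2 := hσ _ _ (hne hxy)
    have e3 := hσ _ _ (hne (hne hxy))
    rw [h1, h2] at e3
    tauto
  · have e1 := hσ x y hxy
    have e2 := hσ _ _ (hne hxy)
    have e3 := hσ _ _ (hne (hne hxy))
    have e4 := hσ _ _ (hne (hne (hne hxy)))
    have e5 := hσ _ _ (hne (hne (hne (hne hxy))))
    rw [h1, h2] at e5
    tauto
  -- Adjacency alternates along the 4-cycle of `σ`, so its starting point may be shifted by one.
  -- What remains free is one diagonal and one adjacency at the fixed point `z`: two choices give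
  -- bulls, two give 5-cycles.
  · wlog hp : G.Adj x (σ x) generalizing x with H
    · have hx : x ≠ σ x := fun h => h2 (by rw [← h, ← h])
      refine H (σ x) (by rw [h1]) (hne h2) ?_
      exact (hσ _ _ hx).2 hp
    have hx : x ≠ σ x := hp.ne
    have hz : z ≠ x := fun h => hx (by rw [← h, h3])
    have p1 := hσ _ _ hx
    have p2 := hσ _ _ (hne hx)
    have p3 := hσ _ _ (hne (hne hx))
    have q1 := hσ _ _ h2
    have r1 := hσ _ _ hz
    have r2 := hσ _ _ (hne hz)
    have r3 := hσ _ _ (hne (hne hz))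
    rw [h1] at p3
    simp only [h3] at r1 r2 r3
    generalize hv1 : σ x = v₁ at *
    generalize hv2 : σ v₁ = v₂ at *
    generalize hv3 : σ v₂ = v₃ at *
    have n12 : ¬ G.Adj v₁ v₂ := fun h => p1.1 h hp
    have a23 : G.Adj v₂ v₃ := p2.2 n12
    have n30 : ¬ G.Adj v₃ x := fun h => p3.1 h a23
    have n03 : ¬ G.Adj x v₃ := fun h => n30 h.symm
    by_cases q : G.Adj v₂ x <;> by_cases r : G.Adj z x
    · have q' : ¬ G.Adj v₃ v₁ := fun h => q1.1 h q
      have z1 : ¬ G.Adj z v₁ := fun h => r1.1 h r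
      have z2 : G.Adj z v₂ := r2.2 z1
      have z3 : ¬ G.Adj z v₃ := fun h => r3.1 h z2
      exact nonempty_iso_bull hcard hp.symm r.symm z2 a23 q.symm (fun h => z1 h.symm) n12
        (fun h => q' h.symm) n03 z3
    · have q' : ¬ G.Adj v₃ v₁ := fun h => q1.1 h q
      have z1 : G.Adj z v₁ := r1.2 r
      have z2 : ¬ G.Adj z v₂ := fun h => r2.1 h z1
      have z3 : G.Adj z v₃ := r3.2 z2
      exact (hG.not_cycle_five hp.symm q.symm a23 z3.symm z1 n12 (fun h => q' h.symm) n03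
        (fun h => r h.symm) (fun h => z2 h.symm)).elim
    · have q' : G.Adj v₃ v₁ := q1.2 q
      have z1 : ¬ G.Adj z v₁ := fun h => r1.1 h r
      have z2 : G.Adj z v₂ := r2.2 z1
      have z3 : ¬ G.Adj z v₃ := fun h => r3.1 h z2
      exact (hG.not_cycle_five hp q'.symm a23.symm z2.symm r n03 (fun h => q h.symm) n12
        (fun h => z1 h.symm) (fun h => z3 h.symm)).elim
    · have q' : G.Adj v₃ v₁ := q1.2 q
      have z1 : G.Adj z v₁ := r1.2 r
      have z2 : ¬ G.Adj z v₂ := fun h => r2.1 h z1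
      have z3 : G.Adj z v₃ := r3.2 z2
      exact nonempty_iso_bull hcard hp z1.symm z3 a23.symm q'.symm (fun h => r h.symm) n03
        (fun h => q h.symm) n12 z2

end

/-! ### Counting edges between the colour classes -/

section

open Classical in
/-- The number of neighbours of `v` in the other colour classes. -/
noncomputable def crossDegree {V : Type} [Fintype V] (G : SimpleGraph V) (c : V → Fin 3) (v : V) :
    ℕ :=
  (Finset.univ.filter fun w => G.Adj v w ∧ c w ≠ c v).card

variable {V : Type} [Fintype V] {G : SimpleGraph V} {c : V → Fin 3} {par : V → Bool}
  {port : V → V → Fin 3}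

open Classical in
/-- The number of vertices of colour `i`. -/
noncomputable def classSize (c : V → Fin 3) (i : Fin 3) : ℕ :=
  (Finset.univ.filter fun w => c w = i).card

open Classical in
lemma WallLike.degree_add_one (hG : WallLike G c par port) (v : V) :
    (Finset.univ.filter fun w => G.Adj v w).card + 1 = classSize c (c v) + crossDegree G c v := by
  have h1 : (Finset.univ.filter fun w => c w = c v) =
      insert v (Finset.univ.filter fun w => G.Adj v w ∧ c w = c v) := by
    ext w
    simp only [Finset.mem_filter, Finset.mem_univ, true_and, Finset.mem_insert]
    constructor
    · intro h
      by_cases hw : w = v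
      · exact Or.inl hw
      · exact Or.inr ⟨(hG.adj_of_eq w v hw h).symm, h⟩
    · rintro (rfl | h)
      · rfl
      · exact h.2
  rw [classSize, h1, Finset.card_insert_of_notMem (by simp), crossDegree,
    ← Finset.card_filter_add_card_filter_not (s := Finset.univ.filter fun w => G.Adj v w)
      (fun w => c w = c v), Finset.filter_filter, Finset.filter_filter]
  simp only [ne_eq]
  omega

open Classical in
lemma WallLike.crossDegree_le_three (hG : WallLike G c par port) {v : V} (hv : c v = 0) :
    crossDegree G c v ≤ 3 := by
  rw [show (3 : ℕ) = (Finset.univ : Finset (Fin 3)).card by simp, crossDegree]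
  refine Finset.card_le_card_of_injOn (port v) (by simp) ?_
  intro e he f hf hef
  simp only [Finset.coe_filter, Finset.mem_univ, true_and, hv] at he hf
  exact hG.port_inj v e f hv he.2 hf.2 he.1 hf.1 hef

open Classical in
lemma WallLike.crossDegree_le_two (hG : WallLike G c par port) {e : V} (he : c e ≠ 0) :
    crossDegree G c e ≤ 2 := by
  rw [show (2 : ℕ) = (Finset.univ : Finset Bool).card by simp, crossDegree]
  refine Finset.card_le_card_of_injOn par (fun _ _ => Finset.mem_coe.2 (Finset.mem_univ _)) ?_
  intro u hu v hv huv
  simp only [Finset.coe_filter, Finset.mem_univ, true_and] at hu hv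
  by_contra hne
  exact hG.par_ne e u v he (hG.eq_zero_of_adj he hu.1 hu.2) (hG.eq_zero_of_adj he hv.1 hv.2)
    hu.1 hv.1 hne huv

open Classical in
lemma WallLike.sum_crossDegree (hG : WallLike G c par port) :
    ∑ v with c v = 0, crossDegree G c v = ∑ e with c e ≠ 0, crossDegree G c e := by
  have h := Finset.sum_card_bipartiteAbove_eq_sum_card_bipartiteBelow
    (s := Finset.univ.filter fun v => c v = 0) (t := Finset.univ.filter fun v => c v ≠ 0) G.Adj
  convert h using 2 with v hv e he
  · rw [crossDegree, Finset.bipartiteAbove, Finset.filter_filter]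
    simp only [Finset.mem_filter, Finset.mem_univ, true_and] at hv
    congr 1
    ext w
    simp [hv, and_comm]
  · rw [crossDegree, Finset.bipartiteBelow, Finset.filter_filter]
    simp only [Finset.mem_filter, Finset.mem_univ, true_and] at he
    congr 1
    ext w
    simp only [Finset.mem_filter, Finset.mem_univ, true_and]
    constructor
    · rintro ⟨h1, h2⟩
      exact ⟨hG.eq_zero_of_adj he h1 h2, h1.symm⟩
    · rintro ⟨h1, h2⟩
      exact ⟨h2.symm, by rw [h1]; exact Ne.symm he⟩

open Classical in
/-- At most two edges of the wall have both ends among three given vertices. -/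
lemma WallLike.card_full_le_two (hG : WallLike G c par port) (h0 : classSize c 0 = 3) :
    (Finset.univ.filter fun e => c e ≠ 0 ∧ crossDegree G c e = 2).card ≤ 2 := by
  set S := Finset.univ.filter fun v => c v = 0 with hS
  have hS3 : S.card = 3 := h0
  obtain ⟨p, hp, q, hq, hpq, hpar⟩ : ∃ p ∈ S, ∃ q ∈ S, p ≠ q ∧ par p = par q :=
    Finset.exists_ne_map_eq_of_card_lt_of_maps_to (t := Finset.univ) (by simp [hS3])
      (fun _ _ => Finset.mem_coe.2 (Finset.mem_univ _))
  -- Two of the three vertices have equal parity, so only the two other pairs can be the ends of an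
  -- edge.
  have hcard : ((S.powersetCard 2).erase {p, q}).card = 2 := by
    rw [Finset.card_erase_of_mem, Finset.card_powersetCard, hS3]
    · rfl
    · rw [Finset.mem_powersetCard]
      exact ⟨by simp [Finset.insert_subset_iff, hp, hq], Finset.card_pair hpq⟩
  refine le_of_le_of_eq ?_ hcard
  have hmem : ∀ v, v ∈ S ↔ c v = 0 := fun v => by simp [hS]
  refine Finset.card_le_card_of_injOn
    (fun e => Finset.univ.filter fun w => G.Adj e w ∧ c w ≠ c e) ?_ ?_
  · intro e he
    simp only [Finset.coe_filter, Finset.mem_univ, true_and] at he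
    obtain ⟨he, he2⟩ := he
    simp only [Finset.coe_erase, Set.mem_sdiff, Finset.mem_coe, Finset.mem_powersetCard,
      Set.mem_singleton_iff]
    refine ⟨⟨fun w hw => ?_, he2⟩, fun h => ?_⟩
    · simp only [Finset.mem_filter, Finset.mem_univ, true_and] at hw
      exact (hmem w).2 (hG.eq_zero_of_adj he hw.1 hw.2)
    · have h1 : p ∈ Finset.univ.filter fun w => G.Adj e w ∧ c w ≠ c e := by rw [h]; simp
      have h2 : q ∈ Finset.univ.filter fun w => G.Adj e w ∧ c w ≠ c e := by rw [h]; simp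
      simp only [Finset.mem_filter, Finset.mem_univ, true_and] at h1 h2
      exact hG.par_ne e p q he ((hmem p).1 hp) ((hmem q).1 hq) h1.1 h2.1 hpq hpar
  · intro e he f hf hef
    simp only [Finset.coe_filter, Finset.mem_univ, true_and] at he hf
    obtain ⟨u, v, huv, huv'⟩ := Finset.card_eq_two.1 he.2
    have hu : u ∈ Finset.univ.filter fun w => G.Adj e w ∧ c w ≠ c e := by rw [huv']; simp
    have hv : v ∈ Finset.univ.filter fun w => G.Adj e w ∧ c w ≠ c e := by rw [huv']; simp
    have hu' := hu
    have hv' := hv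
    simp only at hef
    rw [hef] at hu' hv'
    simp only [Finset.mem_filter, Finset.mem_univ, true_and] at hu hv hu' hv'
    exact hG.edge_unique e f u v he.1 hf.1 (hG.eq_zero_of_adj he.1 hu.1 hu.2)
      (hG.eq_zero_of_adj he.1 hv.1 hv.2) huv hu.1 hv.1 hu'.1 hv'.1

open Classical in
lemma classSize_sum : classSize c 0 + classSize c 1 + classSize c 2 = Fintype.card V := by
  have := Finset.card_eq_sum_card_fiberwise (s := (Finset.univ : Finset V))
    (t := (Finset.univ : Finset (Fin 3))) (f := c) (by simp)
  rw [Fin.sum_univ_three, Finset.card_univ] at this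
  exact this.symm

open Classical in
lemma classSize_one_add_two :
    (Finset.univ.filter fun e => c e ≠ 0).card = classSize c 1 + classSize c 2 := by
  have h1 := classSize_sum (c := c)
  have h2 := Finset.card_filter_add_card_filter_not (s := (Finset.univ : Finset V))
    (fun v => c v = 0)
  rw [Finset.card_univ] at h2
  change classSize c 0 + _ = _ at h2
  simp only [ne_eq]
  omega

open Classical in
lemma sum_classSize_sub_one : ∑ v, (classSize c (c v) - 1) =
    classSize c 0 * (classSize c 0 - 1) + classSize c 1 * (classSize c 1 - 1) +
      classSize c 2 * (classSize c 2 - 1) := by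
  rw [← Finset.sum_fiberwise (Finset.univ : Finset V) c, Fin.sum_univ_three]
  have : ∀ i, ∑ v with c v = i, (classSize c (c v) - 1) = classSize c i * (classSize c i - 1) := by
    intro i
    rw [Finset.sum_congr rfl (g := fun _ => classSize c i - 1)
      (fun v hv => by rw [(Finset.mem_filter.1 hv).2]), Finset.sum_const, smul_eq_mul]
    rfl
  rw [this, this, this]

/-! ### Degrees of self-complementary graphs -/

-- A complementing permutation carries the non-neighbours of `v` onto the neighbours of `σ v`.
open Classical in
lemma degree_add_degree (σ : Equiv.Perm V)
    (hσ : ∀ u v, u ≠ v → (G.Adj (σ u) (σ v) ↔ ¬ G.Adj u v)) (v : V) :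
    (Finset.univ.filter fun w => G.Adj v w).card +
      (Finset.univ.filter fun w => G.Adj (σ v) w).card + 1 = Fintype.card V := by
  have h1 : (Finset.univ.filter fun w => G.Adj (σ v) w) =
      (Finset.univ.filter fun w => w ≠ v ∧ ¬ G.Adj v w).map σ.toEmbedding := by
    ext w
    obtain ⟨w, rfl⟩ := σ.surjective w
    simp only [Finset.mem_filter, Finset.mem_univ, true_and, Finset.mem_map_equiv,
      Equiv.symm_apply_apply]
    by_cases h : w = v
    · simp [h]
    · rw [hσ v w (Ne.symm h)]; simp [h]
  have h2 : (Finset.univ.filter fun w => ¬ G.Adj v w) =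
      insert v (Finset.univ.filter fun w => w ≠ v ∧ ¬ G.Adj v w) := by
    ext w
    by_cases h : w = v <;> simp [h]
  have h3 := Finset.card_filter_add_card_filter_not (s := (Finset.univ : Finset V))
    (fun w => G.Adj v w)
  rw [h2, Finset.card_insert_of_notMem (by simp), Finset.card_univ] at h3
  rw [h1, Finset.card_map]
  omega

open Classical in
lemma sum_degree (σ : Equiv.Perm V)
    (hσ : ∀ u v, u ≠ v → (G.Adj (σ u) (σ v) ↔ ¬ G.Adj u v)) :
    2 * ∑ v, (Finset.univ.filter fun w => G.Adj v w).card =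
      Fintype.card V * (Fintype.card V - 1) := by
  rw [two_mul]
  nth_rewrite 2 [← Equiv.sum_comp σ]
  rw [← Finset.sum_add_distrib, Finset.sum_congr rfl (g := fun _ => Fintype.card V - 1)
    (fun v _ => by have := degree_add_degree σ hσ v; omega), Finset.sum_const, smul_eq_mul,
    Finset.card_univ]

/-- The image of a colour class under `σ` is independent, so its vertices have distinct colours. -/
lemma WallLike.classSize_le_three (hG : WallLike G c par port) (σ : Equiv.Perm V)
    (hσ : ∀ u v, u ≠ v → (G.Adj (σ u) (σ v) ↔ ¬ G.Adj u v)) (i : Fin 3) :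
    classSize c i ≤ 3 := by
  rw [show (3 : ℕ) = (Finset.univ : Finset (Fin 3)).card by simp, classSize]
  refine Finset.card_le_card_of_injOn (c ∘ σ) (by simp) ?_
  intro u hu v hv huv
  simp only [Finset.coe_filter, Finset.mem_univ, true_and] at hu hv
  by_contra hne
  exact (hσ u v hne).1 (hG.adj_of_eq _ _ (σ.injective.ne hne) huv)
    (hG.adj_of_eq u v hne (Eq.trans hu (Eq.symm hv)))

/-- Here `a`, `b`, `d` are the class sizes and `X` counts the cross edges; `hX` says that the graph
has half of all possible edges. -/
lemma classSize_cases {n a b d X : ℕ} (ha : a ≤ 3) (hb : b ≤ 3) (hd : d ≤ 3)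
    (hn : a + b + d = n) (h5 : 5 ≤ n)
    (hX : 2 * (a * (a - 1) + b * (b - 1) + d * (d - 1) + 2 * X) = n * (n - 1))
    (hXa : X ≤ 3 * a) (hX3 : a = 3 → X ≤ b + d + 2) :
    n = 5 ∨ (n = 8 ∧ a = 3 ∧ X = 7 ∧ ((b = 2 ∧ d = 3) ∨ (b = 3 ∧ d = 2))) := by
  subst hn
  interval_cases a <;> interval_cases b <;> interval_cases d <;> simp at * <;> omega

open Classical in
lemma WallLike.card_eq_five (hG : WallLike G c par port) (σ : Equiv.Perm V)
    (hσ : ∀ u v, u ≠ v → (G.Adj (σ u) (σ v) ↔ ¬ G.Adj u v)) (h5 : 5 ≤ Fintype.card V) :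
    Fintype.card V = 5 := by
  have hsumX := hG.sum_crossDegree
  have hsum : ∑ v, (Finset.univ.filter fun w => G.Adj v w).card =
      ∑ v, (classSize c (c v) - 1) + 2 * ∑ v with c v = 0, crossDegree G c v := by
    rw [two_mul]
    -- Counting the cross edges once from each side makes the two sums range over all vertices
    -- together.
    nth_rewrite 2 [hsumX]
    rw [Finset.sum_filter_add_sum_filter_not, ← Finset.sum_add_distrib]
    refine Finset.sum_congr rfl fun v _ => ?_
    have h1 := hG.degree_add_one v
    have h2 : 0 < classSize c (c v) := Finset.card_pos.2 ⟨v, by simp⟩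
    omega
  have hdeg := sum_degree σ hσ
  rw [hsum, sum_classSize_sub_one] at hdeg
  have hX0 : ∑ v with c v = 0, crossDegree G c v ≤ 3 * classSize c 0 := by
    rw [mul_comm]
    exact Finset.sum_le_card_nsmul _ _ 3
      fun v hv => hG.crossDegree_le_three (Finset.mem_filter.1 hv).2
  have hfull : ∑ e with c e ≠ 0, (1 + if crossDegree G c e = 2 then 1 else 0) =
      classSize c 1 + classSize c 2 +
        (Finset.univ.filter fun e => c e ≠ 0 ∧ crossDegree G c e = 2).card := by
    rw [Finset.sum_add_distrib, Finset.sum_const, smul_eq_mul, mul_one, classSize_one_add_two,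
      Finset.sum_boole, Finset.filter_filter]
    simp
  have hle : ∀ e ∈ Finset.univ.filter fun e => c e ≠ 0, crossDegree G c e ≤
      1 + if crossDegree G c e = 2 then 1 else 0 := by
    intro e he
    have := hG.crossDegree_le_two (Finset.mem_filter.1 he).2
    split_ifs <;> omega
  have hX1 : classSize c 0 = 3 →
      ∑ v with c v = 0, crossDegree G c v ≤ classSize c 1 + classSize c 2 + 2 := by
    intro h3
    have h1 := Finset.sum_le_sum hle
    have h2 := hG.card_full_le_two h3
    omega
  rcases classSize_cases (hG.classSize_le_three σ hσ 0) (hG.classSize_le_three σ hσ 1)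
    (hG.classSize_le_three σ hσ 2) classSize_sum h5 hdeg hX0 hX1 with h | ⟨h8, h3, hX7, hbd⟩
  · exact h
  exfalso
  -- In the case of eight vertices the bound `X ≤ b + d + 2` is tight, so no edge vertex has cross
  -- degree 0.
  have hpos1 : ∀ e, c e ≠ 0 → 1 ≤ crossDegree G c e := by
    intro e he
    by_contra hlt
    have h1 : ∑ e with c e ≠ 0, crossDegree G c e <
        ∑ e with c e ≠ 0, (1 + if crossDegree G c e = 2 then 1 else 0) :=
      Finset.sum_lt_sum hle ⟨e, by simp [he], by split_ifs <;> omega⟩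
    have h2 := hG.card_full_le_two h3
    omega
  have hS : (Finset.univ.filter fun v => c v = 0).card = 3 := h3
  have hpos0 : ∀ v, c v = 0 → 1 ≤ crossDegree G c v := by
    intro v hv
    have hmem : v ∈ Finset.univ.filter fun v => c v = 0 := by simp [hv]
    have h1 := Finset.add_sum_erase _ (fun v => crossDegree G c v) hmem
    have h2 := Finset.sum_le_card_nsmul ((Finset.univ.filter fun v => c v = 0).erase v)
      (fun v => crossDegree G c v) 3
      fun v hv => hG.crossDegree_le_three (Finset.mem_filter.1 (Finset.mem_of_mem_erase hv)).2
    rw [Finset.card_erase_of_mem hmem, hS, smul_eq_mul] at h2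
    omega
  have hpos : ∀ v, 1 ≤ crossDegree G c v := fun v =>
    if hv : c v = 0 then hpos0 v hv else hpos1 v hv
  -- Seven cross edges at three vertices force cross degree 3 somewhere, hence degree 5. Degrees
  -- along an orbit of `σ` then alternate between 5 and 2.
  obtain ⟨p, hp0, hp⟩ : ∃ p, c p = 0 ∧ crossDegree G c p = 3 := by
    by_contra! hcon
    have h2 := Finset.sum_le_card_nsmul (Finset.univ.filter fun v => c v = 0)
      (fun v => crossDegree G c v) 2 fun v hv => by
        have h0 := (Finset.mem_filter.1 hv).2
        have h1 := hG.crossDegree_le_three h0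
        have h2 := hcon v h0
        omega
    rw [hS, smul_eq_mul] at h2
    omega
  let D : V → ℕ := fun v => (Finset.univ.filter fun w => G.Adj v w).card
  have hD : ∀ v, D v + 1 = classSize c (c v) + crossDegree G c v := hG.degree_add_one
  have hDσ : ∀ v, D v + D (σ v) = 7 := fun v => by
    have := degree_add_degree σ hσ v
    change D v + D (σ v) + 1 = _ at this
    omega
  have hfive : ∀ v, D v = 5 → c v = 0 := by
    intro v hv
    by_contra h0
    have h1 := hD v
    have h2 := hG.classSize_le_three σ hσ (c v)
    have h3 := hG.crossDegree_le_two h0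
    omega
  -- With positive cross degree, degree 2 forces a class of size at most 2, and only one class is
  -- that small.
  have htwo : ∀ u v, D u = 2 → D v = 2 → c u = c v := by
    intro u v hu hv
    have h1 := hD u
    have h2 := hD v
    have h4 := hpos u
    have h5 := hpos v
    have h6 : classSize c (c u) ≤ 2 := by omega
    have h7 : classSize c (c v) ≤ 2 := by omega
    have key : ∀ i : Fin 3, i = 0 ∨ i = 1 ∨ i = 2 := by decide
    rcases key (c u) with hi | hi | hi <;> rcases key (c v) with hj | hj | hj <;>
      rw [hi] at h6 ⊢ <;> rw [hj] at h7 ⊢ <;> omega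
  have hp5 : D p = 5 := by
    have := hD p
    rw [hp0] at this
    omega
  have hp1 := hDσ p
  have hp2 := hDσ (σ p)
  have hp3 := hDσ (σ (σ p))
  have hne : p ≠ σ p := fun h => by rw [← h] at hp1; omega
  by_cases hq : σ (σ p) = p
  · have := hσ p (σ p) hne
    rw [hq, G.adj_comm] at this
    tauto
  -- The pair `p`, `σ (σ p)` and its image under `σ` are both monochromatic, hence both adjacent,
  -- although `σ` complements.
  · have hc := hfive (σ (σ p)) (by omega)
    have ha := hG.adj_of_eq _ _ hq (hc.trans hp0.symm)
    have hc' := htwo (σ (σ (σ p))) (σ p) (by omega) (by omega)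
    exact (hσ _ _ hq).1 (hG.adj_of_eq _ _ (σ.injective.ne hq) hc') ha

end

theorem complementedWall_mem_freeGraphs (h : ℕ) : complementedWall h ∈
    freeGraphs ({fourP1, coThreeP1AddP2} ∪ selfComplementaryNonBull) := by
  obtain ⟨c, par, port, hW⟩ := exists_wallLike_complementedWall h
  rintro H ((rfl | rfl) | ⟨⟨σ⟩, h5, hbull⟩)
  · exact hW.not_fourP1
  · exact hW.not_coThreeP1AddP2
  · rintro ⟨f⟩
    have := H.finite
    have := Fintype.ofFinite H.V
    rw [Nat.card_eq_fintype_card] at h5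
    have hσ : ∀ u v, u ≠ v → (H.graph.Adj (σ u) (σ v) ↔ ¬ H.graph.Adj u v) := by
      intro u v huv
      have h1 := σ.map_adj_iff (v := u) (w := v)
      rw [compl_adj] at h1
      have h2 := σ.injective.ne huv
      tauto
    have hH := hW.comap f
    have hc := hH.card_eq_five σ.toEquiv hσ h5
    exact hbull.false (nonempty_iso_bull_of_card_eq_five hH hc σ.toEquiv hσ).some

end CliqueWidth

theorem mainTheorem6 :
    CliqueWidth.HasUnboundedCliqueWidth
      (CliqueWidth.freeGraphs ({CliqueWidth.fourP1, CliqueWidth.coThreeP1AddP2} ∪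
        CliqueWidth.selfComplementaryNonBull)) ∧
    (∀ h : ℕ, 1 ≤ h → CliqueWidth.complementedWall h ∈
      CliqueWidth.freeGraphs ({CliqueWidth.fourP1, CliqueWidth.coThreeP1AddP2} ∪
        CliqueWidth.selfComplementaryNonBull)) ∧
    CliqueWidth.HasUnboundedCliqueWidth
      {G | ∃ h : ℕ, 1 ≤ h ∧ G = CliqueWidth.complementedWall h} := by
  refine ⟨?_, fun h _ => CliqueWidth.complementedWall_mem_freeGraphs h,
    CliqueWidth.hasUnboundedCliqueWidth_complementedWall⟩
  rintro ⟨c, hc⟩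
  refine CliqueWidth.hasUnboundedCliqueWidth_complementedWall ⟨c, ?_⟩
  rintro _ ⟨h, _, rfl⟩
  exact hc _ (CliqueWidth.complementedWall_mem_freeGraphs h)
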